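/- Let $m\in\mathbb Z_{>0}$ and $s,s_1\in\mathbb Z$. For $\tau\in\mathbb C$ with $\operatorname{Im}\tau>0$ put $q^x=e^{2\pi i\tau x}$, and for $z_1,z_2,z\in\mathbb C$ with $z_1\notin\mathbb Z+\mathbb Z\tau$ and $j\in\mathbb Z$ define $$\Phi^{[m;s]}(\tau,z_1,z_2)=\sum_{n\in\mathbb Z}\frac{e^{2\pi i m n(z_1+z_2)+2\pi i s z_1}\,q^{mn^2+sn}}{1-e^{2\pi i z_1}q^n},\qquad \Theta_{j,m}(\tau,z)=\sum_{n\in\mathbb Z}e^{2\pi i m z\left(n+\frac{j}{2m}\right)}q^{m\left(n+\frac{j}{2m}\right)^2},$$ $$R_{j,m}(\tau,z)=\sum_{\substack{n\in\mathbb Z\\ n\equiv j \bmod 2m}}\left\{\operatorname{sign}\!\left(n-\tfrac12-j+2m\right)-E\!\left(\left(n-2m\tfrac{\operatorname{Im}z}{\operatorname{Im}\tau}\right)\sqrt{\tfrac{\operatorname{Im}\tau}{m}}\right)\right\}e^{-\frac{\pi i n^2}{2m}\tau+2\pi i n z},$$ where $E(x)=2\int_0^x e^{-\pi u^2}\,du$,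 and $$\tilde\Phi^{[m;s]}(\tau,z_1,z_2)=\Phi^{[m;s]}(\tau,z_1,z_2)-\frac12\sum_{\substack{j\in\mathbb Z\\ s\le j<s+2m}}R_{j,m}\!\left(\tau,\tfrac{z_1-z_2}{2}\right)\Theta_{j,m}(\tau,z_1+z_2).$$ All these series converge absolutely, and for all $\tau,z_1,z_2\in\mathbb C$ with $\operatorname{Im}\tau>0$ and $z_1\notin\mathbb Z+\mathbb Z\tau$ the following hold. (a) $\displaystyle \tilde\Phi^{[m;s]}\!\left(-\frac1\tau,\frac{z_1}\tau,\frac{z_2}\tau\right)=\tau\,e^{\frac{2\pi i m}{\tau}z_1z_2}\,\tilde\Phi^{[m;s_1]}(\tau,z_1,z_2)$ and $\tilde\Phi^{[m;s]}(\tau+1,z_1,z_2)=\tilde\Phi^{[m;s]}(\tau,z_1,z_2)$. (b) For all $a,b\in\mathbb Z$: $\tilde\Phi^{[m;s]}(\tau,z_1+a\tau,z_2+b\tau)=e^{-2\pi i m(bz_1+az_2)}\,q^{-mab}\,\tilde\Phi^{[m;s]}(\tau,z_1,z_2)$ and $\tilde\Phi^{[m;s]}(\tau,z_1+a,z_2+b)=\tilde\Phi^{[m;s]}(\tau,z_1,z_2)$.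 (c) $\tilde\Phi^{[m;s]}(\tau,z_1,z_2)=\tilde\Phi^{[m;s_1]}(\tau,z_1,z_2)$, and $\tilde\Phi^{[m;s]}$ is fixed by the weight $1$, index $m$ action of $SL_2(\mathbb Z)$: for every $\begin{pmatrix}a&b\\c&d\end{pmatrix}\in SL_2(\mathbb Z)$, $$(c\tau+d)^{-1}e^{-\frac{2\pi i m c z_1z_2}{c\tau+d}}\,\tilde\Phi^{[m;s]}\!\left(\frac{a\tau+b}{c\tau+d},\frac{z_1}{c\tau+d},\frac{z_2}{c\tau+d}\right)=\tilde\Phi^{[m;s]}(\tau,z_1,z_2).$$ -/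

import Mathlib

open Complex

noncomputable section

namespace MockTheta

/-- The power `q ^ x` of `q = exp (2 π i τ)`, with the branch `q ^ x = exp (2 π i τ x)`. -/
def qPow (τ x : ℂ) : ℂ := exp (2 * Real.pi * I * τ * x)

/-- The domain on which all the functions below are defined: `Im τ > 0`, and `z₁` is not one of the
poles `a + b τ` (with integers `a`, `b`) of the rank one mock theta functions. There is no condition
on `z₂`. -/
def InDomain (τ z₁ : ℂ) : Prop := 0 < τ.im ∧ ∀ a b : ℤ, z₁ ≠ a + b * τ

/-- The `n`-th term of the series of the mock theta function `Φ^{[m;s]}`. -/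
def phiTerm (m s : ℤ) (τ z₁ z₂ : ℂ) (n : ℤ) : ℂ :=
  exp (2 * Real.pi * I * m * n * (z₁ + z₂) + 2 * Real.pi * I * s * z₁) *
      qPow τ (m * n ^ 2 + s * n) /
    (1 - exp (2 * Real.pi * I * z₁) * qPow τ n)

/-- The rank one mock theta function `Φ^{[m;s]}(τ, z₁, z₂)`. -/
def Phi (m s : ℤ) (τ z₁ z₂ : ℂ) : ℂ := ∑' n : ℤ, phiTerm m s τ z₁ z₂ n

/-- The `n`-th term of the series of the theta function `Θ_{j,m}`. -/
def thetaTerm (j m : ℤ) (τ z : ℂ) (n : ℤ) : ℂ :=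
  exp (2 * Real.pi * I * m * z * (n + j / (2 * m))) * qPow τ (m * (n + j / (2 * m)) ^ 2)

/-- The rank one theta function `Θ_{j,m}(τ, z)`. -/
def Theta (j m : ℤ) (τ z : ℂ) : ℂ := ∑' n : ℤ, thetaTerm j m τ z n

/-- `E(x) = 2 ∫₀ˣ exp (-π u²) du`. -/
def E (x : ℝ) : ℝ := 2 * ∫ u in (0 : ℝ)..x, Real.exp (-Real.pi * u ^ 2)

/-- `ψ_{m,n}(τ, z) = (n - 2 m Im z / Im τ) √(Im τ / m)`. -/
def psi (m n : ℤ) (τ z : ℂ) : ℝ := (n - 2 * m * (z.im / τ.im)) * Real.sqrt (τ.im / m)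

/-- The term of index `n` of the series of `R_{j,m}`. -/
def RTerm (j m : ℤ) (τ z : ℂ) (n : ℤ) : ℂ :=
  ((Real.sign ((n : ℝ) - 1 / 2 - j + 2 * m) - E (psi m n τ z) : ℝ) : ℂ) *
    exp (-(Real.pi * I * n ^ 2) / (2 * m) * τ + 2 * Real.pi * I * n * z)

/-- The function `R_{j,m}(τ, z)`: the sum is over the integers `n` with `n ≡ j mod 2m`. -/
def R (j m : ℤ) (τ z : ℂ) : ℂ := ∑' n : {n : ℤ // n ≡ j [ZMOD 2 * m]}, RTerm j m τ z n

/-- The modifier `Φ_add^{[m;s]}(τ, z₁, z₂)`: the sum is over the integers `s ≤ j < s + 2m`. -/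
def PhiAdd (m s : ℤ) (τ z₁ z₂ : ℂ) : ℂ :=
  ∑ j ∈ Finset.Ico s (s + 2 * m), R j m τ ((z₁ - z₂) / 2) * Theta j m τ (z₁ + z₂)

/-- The modified mock theta function `Φ̃^{[m;s]} = Φ^{[m;s]} - (1/2) Φ_add^{[m;s]}`. -/
def PhiTilde (m s : ℤ) (τ z₁ z₂ : ℂ) : ℂ := Phi m s τ z₁ z₂ - 1 / 2 * PhiAdd m s τ z₁ z₂

/-- The right action of weight `1` and index `m` of `g = (a b; c d) ∈ SL₂(ℤ)` on functions of
`(τ, z₁, z₂)`. -/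
def slash (m : ℤ) (g : Matrix.SpecialLinearGroup (Fin 2) ℤ) (F : ℂ → ℂ → ℂ → ℂ)
    (τ z₁ z₂ : ℂ) : ℂ :=
  (g 1 0 * τ + g 1 1)⁻¹ *
    exp (-(2 * Real.pi * I * m * g 1 0 * z₁ * z₂) / (g 1 0 * τ + g 1 1)) *
    F ((g 0 0 * τ + g 0 1) / (g 1 0 * τ + g 1 1))
      (z₁ / (g 1 0 * τ + g 1 1)) (z₂ / (g 1 0 * τ + g 1 1))

end MockTheta

end

namespace MockTheta

/-! ### Gaussian sums over the integers -/

/-! Write e(x) = exp(2πix). The completion equals a lattice sum, `PhiTilde_eq_latticeSum`: up to the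
factor -e(-m z₁ Im z₂ / Im τ)/(2πi), it is the sum over λ in ℤτ + ℤ of exp(-π m |z₁+λ|² / Im τ) e(m
Im(λ z̄₂) / Im τ) / (z₁+λ). This sum does not involve `s`, which gives independence of `s`. A Möbius
map permutes the lattice and rescales the summand, and translations of z₁ reindex it, while
translations of z₂ change phases by integers, so all the transformation laws can be read off.

The identity is proved row by row, with λ = aτ + b and a fixed. Put w = z₁ + aτ and c = m / Im τ,
and regard the row as a function of a real frequency r, to be evaluated at r = c Im z₂.
Differentiating in r cancels the pole 1/(w+b). Poisson summation turns the remaining Gaussian sum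
into a series whose terms are, up to a constant, derivatives of error functions. So the row equals
πi times an error-function series plus a constant. Under r ↦ r + 1 the row is multiplied by e(-w),
and the series likewise except for one sign jump, which forces the constant to be a multiple of
e(k₀w)/(1 - e(w)) (`poleSum_eq`). With k₀ = s + ma this is the a-th term of Φ, and the error series
is the a-th part of ΣRΘ (`row_eq`). Gaussian bounds make both double series absolutely convergent,
which allows the rows to be summed and the order exchanged. -/

theorem summable_exp_quadratic {A : ℝ} (hA : 0 < A) (B C : ℝ) :
    Summable fun n : ℤ => Real.exp (-A * (n : ℝ) ^ 2 + B * n + C) := by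
  have hpi := Real.pi_pos
  have h := ((summable_jacobiTheta₂_term_iff (((-B / (2 * Real.pi) : ℝ) : ℂ) * I)
    (((A / Real.pi : ℝ) : ℂ) * I)).2 (by simpa using div_pos hA hpi)).norm.mul_right (Real.exp C)
  refine h.congr fun n => ?_
  rw [norm_jacobiTheta₂_term, ← Real.exp_add]
  congr 1
  rw [im_ofReal_mul, im_ofReal_mul, I_im]
  field_simp
  ring

theorem summable_exp_int_prod {A : ℝ} (hA : 0 < A) :
    Summable fun p : ℤ × ℤ => Real.exp (-A * ((p.1 : ℝ) ^ 2 + (p.2 : ℝ) ^ 2)) := by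
  have h := summable_exp_quadratic hA 0 0
  refine (h.mul_of_nonneg h (fun _ => (Real.exp_pos _).le) fun _ => (Real.exp_pos _).le).congr
    fun p => ?_
  rw [← Real.exp_add]
  congr 1
  ring

/-! ### The error function -/

theorem continuous_gaussian : Continuous fun u : ℝ => Real.exp (-Real.pi * u ^ 2) := by
  fun_prop

theorem hasDerivAt_E (x : ℝ) : HasDerivAt E (2 * Real.exp (-Real.pi * x ^ 2)) x :=
  (intervalIntegral.integral_hasDerivAt_right (continuous_gaussian.intervalIntegrable _ _)
    continuous_gaussian.stronglyMeasurable.stronglyMeasurableAtFilter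
    continuous_gaussian.continuousAt).const_mul 2

theorem E_neg (x : ℝ) : E (-x) = -E x := by
  unfold E
  have h := intervalIntegral.integral_comp_neg (a := 0) (b := x)
    fun u : ℝ => Real.exp (-Real.pi * u ^ 2)
  simp only [neg_sq, neg_zero] at h
  rw [h, intervalIntegral.integral_symm]
  ring

theorem monotone_E : Monotone E :=
  monotone_of_hasDerivAt_nonneg (fun x => hasDerivAt_E x) fun x => by positivity

theorem tendsto_E : Filter.Tendsto E Filter.atTop (nhds 1) := by
  have h := (MeasureTheory.intervalIntegral_tendsto_integral_Ioi (μ := MeasureTheory.volume)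
    (f := fun u : ℝ => Real.exp (-Real.pi * u ^ 2)) 0
    (integrable_exp_neg_mul_sq Real.pi_pos).integrableOn Filter.tendsto_id).const_mul 2
  rw [integral_gaussian_Ioi, div_self Real.pi_ne_zero, Real.sqrt_one,
    mul_div_cancel₀ (1 : ℝ) two_ne_zero] at h
  exact h

theorem E_le_one (x : ℝ) : E x ≤ 1 := monotone_E.ge_of_tendsto tendsto_E x

theorem neg_one_le_E (x : ℝ) : -1 ≤ E x := by
  have h := E_le_one (-x)
  rw [E_neg] at h
  linarith

theorem E_add_sub_le {x t : ℝ} (hx : 0 ≤ x) (ht : 0 ≤ t) :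
    E (x + t) - E x ≤ Real.exp (-Real.pi * x ^ 2) := by
  have h0 : E (x + t) - E x = 2 * ∫ u in (0 : ℝ)..t, Real.exp (-Real.pi * (u + x) ^ 2) := by
    rw [intervalIntegral.integral_comp_add_right (fun u : ℝ => Real.exp (-Real.pi * u ^ 2)) x]
    unfold E
    rw [← mul_sub, intervalIntegral.integral_interval_sub_left
      (continuous_gaussian.intervalIntegrable _ _) (continuous_gaussian.intervalIntegrable _ _),
      zero_add, add_comm]
  have h1 : ∫ u in (0 : ℝ)..t, Real.exp (-Real.pi * (u + x) ^ 2) ≤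
      ∫ u in (0 : ℝ)..t, Real.exp (-Real.pi * x ^ 2) * Real.exp (-Real.pi * u ^ 2) := by
    refine intervalIntegral.integral_mono_on ht
      (Continuous.intervalIntegrable (by fun_prop) _ _)
      (Continuous.intervalIntegrable (by fun_prop) _ _) fun u hu => ?_
    rw [← Real.exp_add, Real.exp_le_exp]
    -- For u, x ≥ 0 the cross term in (u + x)² is nonnegative, so the Gaussian at u + x is at most
    -- the product of those at u and x.
    nlinarith [mul_nonneg Real.pi_pos.le (mul_nonneg hu.1 hx)]
  rw [intervalIntegral.integral_const_mul] at h1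
  have h2 := mul_le_mul_of_nonneg_left (E_le_one t) (Real.exp_pos (-Real.pi * x ^ 2)).le
  unfold E at h2
  rw [h0]
  linarith

theorem one_sub_E_le {x : ℝ} (hx : 0 ≤ x) : 1 - E x ≤ Real.exp (-Real.pi * x ^ 2) := by
  have h : Filter.Tendsto (fun t => E (x + t) - E x) Filter.atTop (nhds (1 - E x)) :=
    (tendsto_E.comp (Filter.tendsto_atTop_add_const_left _ x Filter.tendsto_id)).sub_const _
  exact le_of_tendsto h ((Filter.eventually_ge_atTop 0).mono fun t ht => E_add_sub_le hx ht)

/-- The sign of `n - j + 1/2`. -/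
def sgnGE (j n : ℤ) : ℝ := if j ≤ n then 1 else -1

/-- When the sign agrees with that of the argument of `E`, this is the Gaussian tail bound.
Otherwise n + β lies between 0 and j + β: the left side is at most 2, and the constant
exp(π((j+β)α)²) compensates for the Gaussian. -/
theorem abs_sgnGE_sub_E_le (j : ℤ) {α : ℝ} (hα : 0 < α) (β : ℝ) (n : ℤ) :
    |sgnGE j n - E ((n + β) * α)| ≤
      2 * Real.exp (Real.pi * ((j + β) * α) ^ 2) * Real.exp (-Real.pi * ((n + β) * α) ^ 2) := by
  have hl := neg_one_le_E ((n + β) * α)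
  have hu := E_le_one ((n + β) * α)
  have hone : 1 ≤ Real.exp (Real.pi * ((j + β) * α) ^ 2) :=
    Real.one_le_exp (mul_nonneg Real.pi_pos.le (sq_nonneg _))
  have hg := Real.exp_pos (-Real.pi * ((n + β) * α) ^ 2)
  have small : ∀ x : ℝ, |x| ≤ Real.exp (-Real.pi * ((n + β) * α) ^ 2) → |x| ≤
      2 * Real.exp (Real.pi * ((j + β) * α) ^ 2) * Real.exp (-Real.pi * ((n + β) * α) ^ 2) := by
    intro x hx
    nlinarith
  have large : ∀ x : ℝ, |x| ≤ 2 → ((n + β) * α) ^ 2 ≤ ((j + β) * α) ^ 2 → |x| ≤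
      2 * Real.exp (Real.pi * ((j + β) * α) ^ 2) * Real.exp (-Real.pi * ((n + β) * α) ^ 2) := by
    intro x hx h
    have : 1 ≤ Real.exp (Real.pi * ((j + β) * α) ^ 2 + -Real.pi * ((n + β) * α) ^ 2) :=
      Real.one_le_exp (by nlinarith [Real.pi_pos])
    rw [Real.exp_add] at this
    linarith
  unfold sgnGE
  split_ifs with hjn
  · have hjn' : ((j + β) * α) ≤ ((n + β) * α) :=
      mul_le_mul_of_nonneg_right (by simpa using hjn) hα.le
    rcases le_total 0 ((n + β) * α) with h0 | h0
    · exact small _ (by rw [abs_of_nonneg (by linarith)]; exact one_sub_E_le h0)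
    · exact large _ (abs_le.2 ⟨by linarith, by linarith⟩) (by nlinarith)
  · have hjn' : ((n + β) * α) ≤ ((j + β) * α) :=
      mul_le_mul_of_nonneg_right (by simpa using (not_le.1 hjn).le) hα.le
    rcases le_total 0 ((n + β) * α) with h0 | h0
    · exact large _ (abs_le.2 ⟨by linarith, by linarith⟩) (by nlinarith)
    · refine small _ ?_
      have h := one_sub_E_le (neg_nonneg.2 h0)
      rw [E_neg, neg_sq] at h
      rw [abs_of_nonpos (by linarith)]
      linarith

/-! ### One row of the lattice sum -/

/-- The `b`-th term of the Gaussian sum of a row. -/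
noncomputable def gaussRow (c : ℝ) (w : ℂ) (r : ℝ) (b : ℤ) : ℂ :=
  exp (-(Real.pi * c * normSq (w + b) : ℝ) - 2 * Real.pi * I * r * (w + b))

/-- The `k`-th term of the Fourier expansion of the Gaussian sum of a row. -/
noncomputable def fourierRow (c : ℝ) (w : ℂ) (r : ℝ) (k : ℤ) : ℂ :=
  exp (-(Real.pi / c * (k + r - c * w.im) ^ 2 : ℝ) + 2 * Real.pi * I * k * w)

/-- Poisson summation for a Gaussian with a complex linear term; both rows differ from the standard
form by the same factor, independent of the summation index. -/
theorem tsum_gaussRow {c : ℝ} (hc : 0 < c) (w : ℂ) (r : ℝ) :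
    ∑' b : ℤ, gaussRow c w r b = ((√c)⁻¹ : ℝ) * ∑' k : ℤ, fourierRow c w r k := by
  have hc' : (c : ℂ) ≠ 0 := by exact_mod_cast hc.ne'
  have hpow : 1 / (c : ℂ) ^ (1 / 2 : ℂ) = ((√c)⁻¹ : ℝ) := by
    rw [Real.sqrt_eq_rpow, one_div, ofReal_inv, ofReal_cpow hc.le]
    norm_num
  have h := Complex.tsum_exp_neg_quadratic (a := c) (by simpa using hc)
    (-(c * w.re + I * r))
  rw [hpow] at h
  have h1 : ∀ b : ℤ, gaussRow c w r b =
      exp (-(Real.pi * c * (w.re ^ 2 + w.im ^ 2)) - 2 * Real.pi * I * r * (w.re + w.im * I)) *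
        exp (-Real.pi * c * b ^ 2 + 2 * Real.pi * (-(c * w.re + I * r)) * b) := by
    intro b
    rw [gaussRow, ← exp_add, normSq_apply]
    conv_lhs => rw [← re_add_im w]
    congr 1
    simp
    ring
  have h2 : ∀ k : ℤ, fourierRow c w r k =
      exp (-(Real.pi * c * (w.re ^ 2 + w.im ^ 2)) - 2 * Real.pi * I * r * (w.re + w.im * I)) *
        exp (-Real.pi / c * (k + I * (-(c * w.re + I * r))) ^ 2) := by
    intro k
    rw [fourierRow, ← exp_add]
    conv_lhs => rw [← re_add_im w]
    congr 1
    have hI : I ^ 2 = -1 := I_sq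
    have hI3 : I ^ 3 = -I := by rw [pow_succ, hI]; ring
    have hI4 : I ^ 4 = 1 := I_pow_four
    simp [-re_add_im]
    field_simp
    ring_nf
    simp only [hI, hI3, hI4]
    ring
  rw [tsum_congr h1, tsum_congr h2, tsum_mul_left, tsum_mul_left, h]
  ring

theorem norm_gaussRow (c : ℝ) (w : ℂ) (r : ℝ) (b : ℤ) :
    ‖gaussRow c w r b‖ =
      Real.exp (-(Real.pi * c * ((w.re + b) ^ 2 + w.im ^ 2)) + 2 * Real.pi * r * w.im) := by
  have h : (2 * Real.pi * I * r * (w + b)).re = -(2 * Real.pi * r * w.im) := by simp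
  rw [gaussRow, norm_exp, normSq_apply, sub_re, ← ofReal_neg, ofReal_re, h, add_re, add_im,
    intCast_re, intCast_im]
  congr 1
  ring

theorem norm_fourierRow (c : ℝ) (w : ℂ) (r : ℝ) (k : ℤ) :
    ‖fourierRow c w r k‖ =
      Real.exp (-(Real.pi / c * (k + r - c * w.im) ^ 2) - 2 * Real.pi * k * w.im) := by
  rw [fourierRow, norm_exp, add_re, ← ofReal_neg, ofReal_re]
  congr 1
  simp
  ring

/-- A row of the lattice sum, as a function of the frequency shift. -/
noncomputable def poleSum (c : ℝ) (w : ℂ) (r : ℝ) : ℂ := ∑' b : ℤ, gaussRow c w r b / (w + b)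

/-- The series of error functions that completes a row. -/
noncomputable def errorTerm (c : ℝ) (w : ℂ) (k₀ : ℤ) (r : ℝ) (k : ℤ) : ℂ :=
  ((sgnGE k₀ k - E ((k + (r - c * w.im)) * (√c)⁻¹) : ℝ) : ℂ) * exp (2 * Real.pi * I * k * w)

theorem eventually_one_le_norm_add_intCast (w : ℂ) :
    ∀ᶠ b : ℤ in Filter.cofinite, 1 ≤ ‖w + b‖ := by
  -- The exponent is -(b + Re w)². Terms of a summable series tend to 0, so it eventually drops
  -- below -1.
  have h : Filter.Tendsto (fun b : ℤ => Real.exp (-1 * (b : ℝ) ^ 2 + (-2 * w.re) * b + -w.re ^ 2))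
      Filter.cofinite (nhds 0) := (summable_exp_quadratic one_pos _ _).tendsto_cofinite_zero
  filter_upwards [h.eventually_lt_const (Real.exp_pos (-1))] with b hb
  rw [Real.exp_lt_exp] at hb
  refine le_trans ?_ (abs_re_le_norm _)
  rw [add_re, intCast_re, ← one_le_sq_iff_one_le_abs]
  nlinarith

theorem summable_gaussRow_div {c : ℝ} (hc : 0 < c) (w : ℂ) (r : ℝ) :
    Summable fun b : ℤ => gaussRow c w r b / (w + b) := by
  refine Summable.of_norm_bounded_eventually
    (summable_exp_quadratic (mul_pos Real.pi_pos hc) (-2 * Real.pi * c * w.re)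
      (-(Real.pi * c * (w.re ^ 2 + w.im ^ 2)) + 2 * Real.pi * r * w.im)) ?_
  filter_upwards [eventually_one_le_norm_add_intCast w] with b hb
  rw [norm_div]
  refine (div_le_self (norm_nonneg _) hb).trans (le_of_eq ?_)
  rw [norm_gaussRow]
  congr 1
  ring

theorem hasDerivAt_poleSum {c : ℝ} (hc : 0 < c) {w : ℂ} (hw : ∀ b : ℤ, w + b ≠ 0) (r : ℝ) :
    HasDerivAt (poleSum c w) (-(2 * Real.pi * I) * ∑' b : ℤ, gaussRow c w r b) r := by
  rw [← tsum_mul_left]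
  refine hasDerivAt_tsum_of_isPreconnected (t := Metric.ball r 1)
    (g := fun b t => gaussRow c w t b / (w + b))
    (g' := fun b t => -(2 * Real.pi * I) * gaussRow c w t b)
    ((summable_exp_quadratic (mul_pos Real.pi_pos hc) (-2 * Real.pi * c * w.re)
      (-(Real.pi * c * (w.re ^ 2 + w.im ^ 2)) + 2 * Real.pi * (r * w.im + |w.im|))).mul_left
        (2 * Real.pi))
    Metric.isOpen_ball (convex_ball r 1).isPreconnected ?_ ?_ (Metric.mem_ball_self one_pos)
    (summable_gaussRow_div hc w r) (Metric.mem_ball_self one_pos)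
  · intro b t _
    have h1 : HasDerivAt (fun t : ℝ => -(Real.pi * c * normSq (w + b) : ℝ) -
        2 * Real.pi * I * t * (w + b)) (-(2 * Real.pi * I * (w + b))) t := by
      have := ((((ofRealCLM.hasDerivAt (x := t)).const_mul (2 * Real.pi * I)).mul_const
        (w + b)).const_sub (-(Real.pi * c * normSq (w + b) : ℝ) : ℂ))
      simpa using this
    refine (h1.cexp.div_const (w + b)).congr_deriv ?_
    rw [gaussRow]
    field_simp [hw b]
  · intro b t ht
    rw [norm_mul, norm_gaussRow]
    have hn : ‖-(2 * Real.pi * I : ℂ)‖ = 2 * Real.pi := by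
      simp [abs_of_pos Real.pi_pos]
    rw [hn]
    refine mul_le_mul_of_nonneg_left (Real.exp_le_exp.2 ?_) (by positivity)
    have ht' : |t - r| < 1 := by simpa [Real.dist_eq] using ht
    have h2 : (t - r) * w.im ≤ |w.im| := by
      calc (t - r) * w.im ≤ |(t - r) * w.im| := le_abs_self _
        _ = |t - r| * |w.im| := abs_mul _ _
        _ ≤ 1 * |w.im| := mul_le_mul_of_nonneg_right ht'.le (abs_nonneg _)
        _ = |w.im| := one_mul _
    nlinarith [mul_le_mul_of_nonneg_left h2 Real.pi_pos.le]

theorem summable_errorTerm {c : ℝ} (hc : 0 < c) (w : ℂ) (k₀ : ℤ) (r : ℝ) :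
    Summable (errorTerm c w k₀ r) := by
  have hs : 0 < (√c)⁻¹ := inv_pos.2 (Real.sqrt_pos.2 hc)
  have hs2 : (√c)⁻¹ ^ 2 = c⁻¹ := by rw [inv_pow, Real.sq_sqrt hc.le]
  refine Summable.of_norm_bounded
    ((summable_exp_quadratic (div_pos Real.pi_pos hc)
      (-2 * Real.pi / c * (r - c * w.im) - 2 * Real.pi * w.im)
      (-(Real.pi / c) * (r - c * w.im) ^ 2)).mul_left
        (2 * Real.exp (Real.pi * ((k₀ + (r - c * w.im)) * (√c)⁻¹) ^ 2))) fun k => ?_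
  rw [errorTerm, norm_mul, norm_real, Real.norm_eq_abs]
  refine (mul_le_mul_of_nonneg_right (abs_sgnGE_sub_E_le k₀ hs (r - c * w.im) k)
    (norm_nonneg _)).trans (le_of_eq ?_)
  rw [norm_exp, mul_assoc, ← Real.exp_add, mul_pow _ (√c)⁻¹ 2, mul_pow _ (√c)⁻¹ 2, hs2]
  congr 2
  simp
  field_simp
  ring

theorem hasDerivAt_tsum_errorTerm {c : ℝ} (hc : 0 < c) (w : ℂ) (k₀ : ℤ) (r : ℝ) :
    HasDerivAt (fun t => ∑' k : ℤ, errorTerm c w k₀ t k)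
      (-(2 * (√c)⁻¹ : ℝ) * ∑' k : ℤ, fourierRow c w r k) r := by
  have hs : 0 < (√c)⁻¹ := inv_pos.2 (Real.sqrt_pos.2 hc)
  have hs2 : (√c)⁻¹ ^ 2 = c⁻¹ := by rw [inv_pow, Real.sq_sqrt hc.le]
  rw [← tsum_mul_left]
  refine hasDerivAt_tsum_of_isPreconnected (t := Metric.ball r 1)
    (g := fun k t => errorTerm c w k₀ t k)
    (g' := fun k t => -(2 * (√c)⁻¹ : ℝ) * fourierRow c w t k)
    -- The rate is halved to get one majorant for all |t - r| < 1, from (x + δ)² ≥ x²/2 - 1 when |δ|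
    -- ≤ 1.
    ((summable_exp_quadratic (A := Real.pi / c / 2) (by positivity)
      (-(Real.pi / c) * (r - c * w.im) - 2 * Real.pi * w.im)
      (-(Real.pi / c / 2) * (r - c * w.im) ^ 2 + Real.pi / c)).mul_left (2 * (√c)⁻¹))
    Metric.isOpen_ball (convex_ball r 1).isPreconnected ?_ ?_ (Metric.mem_ball_self one_pos)
    (summable_errorTerm hc w k₀ r) (Metric.mem_ball_self one_pos)
  · intro k t _
    have h1 : HasDerivAt (fun t : ℝ => (k + (t - c * w.im)) * (√c)⁻¹) (√c)⁻¹ t := by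
      simpa using ((((hasDerivAt_id t).sub_const (c * w.im)).const_add (k : ℝ)).mul_const (√c)⁻¹)
    have h2 := ((((hasDerivAt_E _).comp t h1).const_sub (sgnGE k₀ k)).ofReal_comp).mul_const
      (exp (2 * Real.pi * I * k * w))
    refine h2.congr_deriv ?_
    have h3 : -Real.pi * ((k + (t - c * w.im)) * (√c)⁻¹) ^ 2 =
        -(Real.pi / c * (k + t - c * w.im) ^ 2) := by
      rw [mul_pow, hs2]
      ring
    rw [fourierRow, exp_add, h3]
    push_cast
    ring
  · intro k t ht
    rw [norm_mul, norm_fourierRow, norm_neg, norm_real, Real.norm_eq_abs,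
      abs_of_pos (mul_pos two_pos hs)]
    refine mul_le_mul_of_nonneg_left (Real.exp_le_exp.2 ?_) (by positivity)
    have ht' : |t - r| < 1 := by simpa [Real.dist_eq] using ht
    have h1 : (t - r) ^ 2 ≤ 1 := by rw [sq_le_one_iff_abs_le_one]; exact ht'.le
    have h2 : (k + r - c * w.im) ^ 2 / 2 - 1 ≤ (k + t - c * w.im) ^ 2 := by
      nlinarith [sq_nonneg (k + r - c * w.im + 2 * (t - r))]
    have h3 := mul_le_mul_of_nonneg_left h2 (div_pos Real.pi_pos hc).le
    linarith

theorem poleSum_add_one (c : ℝ) (w : ℂ) (r : ℝ) :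
    poleSum c w (r + 1) = exp (-(2 * Real.pi * I * w)) * poleSum c w r := by
  rw [poleSum, poleSum, ← tsum_mul_left]
  refine tsum_congr fun b => ?_
  rw [← mul_div_assoc, gaussRow, gaussRow, ← exp_add]
  congr 1
  refine exp_eq_exp_iff_exists_int.2 ⟨-b, ?_⟩
  push_cast
  ring

/-- Raising r and lowering k by one leaves the argument of `E` unchanged; the sign changes only at k
= k₀, which crosses the cut. -/
theorem errorTerm_add_one (c : ℝ) (w : ℂ) (k₀ : ℤ) (r : ℝ) (k : ℤ) :
    errorTerm c w k₀ (r + 1) (k - 1) = exp (-(2 * Real.pi * I * w)) *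
      (errorTerm c w k₀ r k - if k = k₀ then 2 * exp (2 * Real.pi * I * k₀ * w) else 0) := by
  have h1 : (((k - 1 : ℤ) : ℝ) + (r + 1 - c * w.im)) = k + (r - c * w.im) := by
    push_cast; ring
  have h2 : exp (2 * Real.pi * I * (k - 1 : ℤ) * w) =
      exp (-(2 * Real.pi * I * w)) * exp (2 * Real.pi * I * k * w) := by
    rw [← exp_add]; congr 1; push_cast; ring
  rw [errorTerm, errorTerm, h1, h2]
  rcases lt_trichotomy k k₀ with h | rfl | h
  · rw [if_neg h.ne, sgnGE, sgnGE, if_neg (by omega), if_neg (by omega)]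
    ring
  · rw [if_pos rfl, sgnGE, sgnGE, if_neg (by omega), if_pos le_rfl]
    push_cast
    ring
  · rw [if_neg h.ne', sgnGE, sgnGE, if_pos (by omega), if_pos (by omega)]
    ring

theorem tsum_errorTerm_add_one {c : ℝ} (hc : 0 < c) (w : ℂ) (k₀ : ℤ) (r : ℝ) :
    ∑' k : ℤ, errorTerm c w k₀ (r + 1) k = exp (-(2 * Real.pi * I * w)) *
      (∑' k : ℤ, errorTerm c w k₀ r k - 2 * exp (2 * Real.pi * I * k₀ * w)) := by
  have h := hasSum_ite_eq k₀ (2 * exp (2 * Real.pi * I * k₀ * w))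
  rw [← (Equiv.subRight (1 : ℤ)).tsum_eq, ← h.tsum_eq,
    ← (summable_errorTerm hc w k₀ r).tsum_sub h.summable, ← tsum_mul_left]
  exact tsum_congr fun k => errorTerm_add_one c w k₀ r k

theorem poleSum_eq {c : ℝ} (hc : 0 < c) {w : ℂ} (hw : ∀ b : ℤ, w + b ≠ 0) (k₀ : ℤ) (r : ℝ) :
    poleSum c w r = -(2 * Real.pi * I) *
      (exp (2 * Real.pi * I * k₀ * w) / (1 - exp (2 * Real.pi * I * w)) -
        1 / 2 * ∑' k : ℤ, errorTerm c w k₀ r k) := by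
  have hd : ∀ t, HasDerivAt
      (fun t => poleSum c w t - Real.pi * I * ∑' k : ℤ, errorTerm c w k₀ t k) 0 t := by
    intro t
    refine ((hasDerivAt_poleSum hc hw t).sub
      ((hasDerivAt_tsum_errorTerm hc w k₀ t).const_mul (Real.pi * I))).congr_deriv ?_
    rw [tsum_gaussRow hc]
    push_cast
    ring
  have h := is_const_of_deriv_eq_zero (fun t => (hd t).differentiableAt) (fun t => (hd t).deriv)
    (r + 1) r
  rw [poleSum_add_one, tsum_errorTerm_add_one hc] at h
  have h1 : 1 - exp (2 * Real.pi * I * w) ≠ 0 := by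
    intro h0
    obtain ⟨n, hn⟩ := exp_eq_one_iff.1 (sub_eq_zero.1 h0).symm
    refine hw (-n) ?_
    have h2 : (2 * Real.pi * I) * (w + (-n : ℤ)) = 0 := by
      push_cast
      linear_combination hn
    exact (mul_eq_zero.1 h2).resolve_left two_pi_I_ne_zero
  have h2 : exp (2 * Real.pi * I * w) * exp (-(2 * Real.pi * I * w)) = 1 := by
    rw [← exp_add, add_neg_cancel, exp_zero]
  generalize exp (2 * Real.pi * I * k₀ * w) = e₀ at h ⊢
  have h3 : (1 - exp (2 * Real.pi * I * w)) * poleSum c w r = -(2 * Real.pi * I) *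
      (e₀ - 1 / 2 * (1 - exp (2 * Real.pi * I * w)) * ∑' k : ℤ, errorTerm c w k₀ r k) := by
    -- Comparing the constant at r + 1 and r, multiplied by e(w), gives a linear equation for the
    -- row with coefficient 1 - e(w), nonzero because w is not an integer.
    linear_combination exp (2 * Real.pi * I * w) * h - (poleSum c w r -
      Real.pi * I * (∑' k : ℤ, errorTerm c w k₀ r k - 2 * e₀)) * h2
  generalize exp (2 * Real.pi * I * w) = e₁ at h1 h3 ⊢
  rw [← mul_right_inj' h1, h3]
  field_simp

/-! ### The lattice sum -/

/-- The term of index `aτ + b` of the lattice sum. -/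
noncomputable def latticeTerm (m : ℤ) (τ z₁ z₂ : ℂ) (p : ℤ × ℤ) : ℂ :=
  exp (-(Real.pi * m / τ.im * normSq (z₁ + (p.1 * τ + p.2)) : ℝ) + 2 * Real.pi * I *
    (m / τ.im * ((p.1 * τ + p.2) * (starRingEnd ℂ) z₂).im : ℝ)) / (z₁ + (p.1 * τ + p.2))

/-- The non-holomorphic Kronecker type lattice sum that represents `Φ̃^{[m;s]}`. -/
noncomputable def latticeSum (m : ℤ) (τ z₁ z₂ : ℂ) : ℂ :=
  -(2 * Real.pi * I)⁻¹ * (exp (-(2 * Real.pi * I * m * z₁ * (z₂.im / τ.im))) *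
    ∑' p : ℤ × ℤ, latticeTerm m τ z₁ z₂ p)

theorem InDomain.add_ne_zero {τ z₁ : ℂ} (h : InDomain τ z₁) (a b : ℤ) :
    z₁ + (a * τ + b) ≠ 0 := by
  intro h0
  refine h.2 (-b) (-a) ?_
  push_cast
  linear_combination h0

theorem le_normSq_lattice {τ : ℂ} (hτ : 0 < τ.im) :
    ∃ ε : ℝ, 0 < ε ∧ ∀ (z : ℂ) (a b : ℤ),
      ε * ((a : ℝ) ^ 2 + (b : ℝ) ^ 2) - normSq z ≤ normSq (z + (a * τ + b)) := by
  -- From b² ≤ 2(a Re τ + b)² + 2a²(Re τ)², together with a² = (a Im τ)² / (Im τ)².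
  set M : ℝ := 2 + (2 * τ.re ^ 2 + 1) / τ.im ^ 2 with hM
  have hM0 : 0 < M := by positivity
  refine ⟨(2 * M)⁻¹, by positivity, fun z a b => ?_⟩
  have h1 : (a : ℝ) ^ 2 + (b : ℝ) ^ 2 ≤ M * ((a * τ.re + b) ^ 2 + (a * τ.im) ^ 2) := by
    have e : M * ((a * τ.re + b) ^ 2 + (a * τ.im) ^ 2) =
        2 * ((a * τ.re + b) ^ 2 + (a * τ.im) ^ 2) + (2 * τ.re ^ 2 + 1) * (a : ℝ) ^ 2 +
          (2 * τ.re ^ 2 + 1) / τ.im ^ 2 * (a * τ.re + b) ^ 2 := by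
      rw [hM]
      field_simp
      ring
    have h0 : 0 ≤ (2 * τ.re ^ 2 + 1) / τ.im ^ 2 * (a * τ.re + b) ^ 2 := by positivity
    nlinarith [sq_nonneg ((a : ℝ) * τ.im), sq_nonneg (2 * (a : ℝ) * τ.re + b)]
  have h2 : (a * τ.re + b) ^ 2 + (a * τ.im) ^ 2 ≤
      2 * (normSq (z + (a * τ + b)) + normSq z) := by
    rw [normSq_apply, normSq_apply]
    simp only [add_re, add_im, mul_re, mul_im, intCast_re, intCast_im]
    nlinarith [sq_nonneg (2 * z.re + (a * τ.re + b)), sq_nonneg (2 * z.im + a * τ.im)]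
  have h3 := h1.trans (mul_le_mul_of_nonneg_left h2 hM0.le)
  rw [sub_le_iff_le_add, inv_mul_le_iff₀ (by positivity)]
  linarith

theorem summable_latticeTerm {m : ℤ} (hm : 0 < m) {τ : ℂ} (hτ : 0 < τ.im) (z₁ z₂ : ℂ) :
    Summable (latticeTerm m τ z₁ z₂) := by
  have hm' : (0 : ℝ) < m := by exact_mod_cast hm
  have hc : 0 < Real.pi * m / τ.im := by have := Real.pi_pos; positivity
  obtain ⟨ε, hε, hle⟩ := le_normSq_lattice hτ
  have hs : Summable fun p : ℤ × ℤ =>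
      Real.exp (-(Real.pi * m / τ.im * normSq (z₁ + (p.1 * τ + p.2)))) := by
    refine ((summable_exp_int_prod (mul_pos hc hε)).mul_left
      (Real.exp (Real.pi * m / τ.im * normSq z₁))).of_nonneg_of_le
        (fun _ => (Real.exp_pos _).le) fun p => ?_
    rw [← Real.exp_add, Real.exp_le_exp]
    have := mul_le_mul_of_nonneg_left (hle z₁ p.1 p.2) hc.le
    linarith
  refine hs.of_norm_bounded_eventually ?_
  filter_upwards [hs.tendsto_cofinite_zero.eventually_lt_const
    (Real.exp_pos (-(Real.pi * m / τ.im * 1)))] with p hp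
  -- Smallness of the Gaussian forces |z₁ + λ| > 1 for all but finitely many λ, so the denominator
  -- can be dropped.
  rw [Real.exp_lt_exp, neg_lt_neg_iff, mul_lt_mul_iff_right₀ hc, normSq_eq_norm_sq] at hp
  rw [latticeTerm, norm_div, norm_exp, add_re, ← ofReal_neg, ofReal_re]
  refine (div_le_self (Real.exp_pos _).le ?_).trans (le_of_eq ?_)
  · nlinarith [norm_nonneg (z₁ + (p.1 * τ + p.2))]
  · congr 1
    rw [mul_comm (2 * Real.pi * I : ℂ), re_ofReal_mul]
    simp

/-! ### The completion as a double series -/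

/-- The summand of `R` with the sign cut at `s`, for all integers `n`. -/
noncomputable def cutTerm (m s : ℤ) (τ z : ℂ) (n : ℤ) : ℂ :=
  ((sgnGE s n - E (psi m n τ z) : ℝ) : ℂ) *
    exp (-(Real.pi * I * n ^ 2) / (2 * m) * τ + 2 * Real.pi * I * n * z)

/-- The exponential grows like exp(π n² Im τ / (2m)), but the error-function tail decays like exp(-π
n² Im τ / m), leaving a Gaussian of rate π Im τ / (2m). -/
theorem summable_cutTerm {m : ℤ} (hm : 0 < m) (s : ℤ) {τ : ℂ} (hτ : 0 < τ.im) (z : ℂ) :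
    Summable (cutTerm m s τ z) := by
  have hm' : (0 : ℝ) < m := by exact_mod_cast hm
  have hα : 0 < √(τ.im / m) := Real.sqrt_pos.2 (div_pos hτ hm')
  have hα2 : √(τ.im / m) ^ 2 = τ.im / m := Real.sq_sqrt (div_pos hτ hm').le
  set β : ℝ := -(2 * m * (z.im / τ.im)) with hβ
  have hpi := Real.pi_pos
  refine Summable.of_norm_bounded
    ((summable_exp_quadratic (A := Real.pi * τ.im / (2 * m)) (by positivity)
      (-(2 * Real.pi * β * (τ.im / m)) - 2 * Real.pi * z.im)
      (-(Real.pi * β ^ 2 * (τ.im / m)))).mul_left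
        (2 * Real.exp (Real.pi * ((s + β) * √(τ.im / m)) ^ 2))) fun n => ?_
  have hψ : psi m n τ z = (n + β) * √(τ.im / m) := by rw [psi, hβ, sub_eq_add_neg]
  have hre : (-(Real.pi * I * n ^ 2) / (2 * m) * τ + 2 * Real.pi * I * n * z).re =
      Real.pi * n ^ 2 / (2 * m) * τ.im - 2 * Real.pi * n * z.im := by
    have h : -(Real.pi * I * n ^ 2) / (2 * m) * τ + 2 * Real.pi * I * n * z =
        I * ((-(Real.pi * n ^ 2 / (2 * m)) : ℝ) * τ + (2 * Real.pi * n : ℝ) * z) := by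
      push_cast
      ring
    rw [h, I_mul_re, add_im, im_ofReal_mul, im_ofReal_mul]
    ring
  rw [cutTerm, norm_mul, norm_real, Real.norm_eq_abs, norm_exp, hre, hψ]
  refine (mul_le_mul_of_nonneg_right (abs_sgnGE_sub_E_le s hα β n) (Real.exp_pos _).le).trans
    (le_of_eq ?_)
  rw [mul_assoc, ← Real.exp_add, mul_pow _ √(τ.im / m) 2, mul_pow _ √(τ.im / m) 2, hα2]
  congr 2
  field_simp
  ring

theorem thetaTerm_eq_exp (j m : ℤ) (τ z : ℂ) (n : ℤ) : thetaTerm j m τ z n =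
    exp (2 * Real.pi * I * m * z * (n + j / (2 * m)) +
      2 * Real.pi * I * τ * (m * (n + j / (2 * m)) ^ 2)) := by
  rw [thetaTerm, qPow, ← exp_add]

theorem summable_thetaTerm {m : ℤ} (hm : 0 < m) (j : ℤ) {τ : ℂ} (hτ : 0 < τ.im) (z : ℂ) :
    Summable (thetaTerm j m τ z) := by
  have hm' : (0 : ℝ) < m := by exact_mod_cast hm
  have hpi := Real.pi_pos
  refine Summable.of_norm_bounded
    (summable_exp_quadratic (A := 2 * Real.pi * m * τ.im) (by positivity)
      (-(2 * Real.pi * m * z.im) - 2 * (2 * Real.pi * m * τ.im) * (j / (2 * m)))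
      (-(2 * Real.pi * m * z.im) * (j / (2 * m)) -
        (2 * Real.pi * m * τ.im) * (j / (2 * m)) ^ 2)) fun n => ?_
  rw [thetaTerm_eq_exp, norm_exp]
  refine le_of_eq ?_
  have h : 2 * Real.pi * I * m * z * (n + j / (2 * m)) +
      2 * Real.pi * I * τ * (m * (n + j / (2 * m)) ^ 2) =
      I * ((2 * Real.pi * m * (n + j / (2 * m)) : ℝ) * z +
        (2 * Real.pi * (m * (n + j / (2 * m)) ^ 2) : ℝ) * τ) := by
    push_cast
    ring
  rw [h, I_mul_re, add_im, im_ofReal_mul, im_ofReal_mul]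
  congr 1
  ring

theorem thetaTerm_add_mul {m : ℤ} (hm : 0 < m) (j t : ℤ) (τ z : ℂ) (n : ℤ) :
    thetaTerm (j + 2 * m * t) m τ z n = thetaTerm j m τ z (n + t) := by
  have hm' : (m : ℂ) ≠ 0 := by exact_mod_cast hm.ne'
  have h : (n : ℂ) + ((j + 2 * m * t : ℤ) : ℂ) / (2 * m) = ((n + t : ℤ) : ℂ) + j / (2 * m) := by
    push_cast
    field_simp
    ring
  rw [thetaTerm, thetaTerm, h]

theorem exists_eq_add_of_modEq {m n j : ℤ} (h : n ≡ j [ZMOD 2 * m]) :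
    ∃ t : ℤ, n = j + 2 * m * t := by
  obtain ⟨t, ht⟩ := h.symm.dvd
  exact ⟨t, by linarith⟩

/-- The unique representative in `[s, s + 2m)` of a residue class modulo `2m`. -/
theorem modEq_iff_eq_representative {m : ℤ} (s n : ℤ) {j : ℤ}
    (hj : j ∈ Finset.Ico s (s + 2 * m)) :
    n ≡ j [ZMOD 2 * m] ↔ j = s + (n - s) % (2 * m) := by
  rw [Finset.mem_Ico] at hj
  constructor
  · intro h
    have h1 : (n - s) % (2 * m) = (j - s) % (2 * m) := h.sub_right s
    rw [h1, Int.emod_eq_of_lt (by linarith) (by linarith)]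
    ring
  · intro h
    have h1 := Int.emod_add_mul_ediv (n - s) (2 * m)
    refine (Int.modEq_iff_dvd.2 ⟨-((n - s) / (2 * m)), ?_⟩)
    rw [h]
    linarith

theorem representative_mem {m : ℤ} (hm : 0 < m) (s n : ℤ) :
    s + (n - s) % (2 * m) ∈ Finset.Ico s (s + 2 * m) := by
  have h1 := Int.emod_nonneg (n - s) (b := 2 * m) (by linarith)
  have h2 := Int.emod_lt_of_pos (n - s) (b := 2 * m) (by linarith)
  rw [Finset.mem_Ico]
  constructor <;> linarith

/-- For n = j + 2mt the sign in `RTerm` is positive exactly when t ≥ 0, and since s ≤ j < s + 2m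
this means n ≥ s. Hence all residue classes share the single cut at s. -/
theorem RTerm_eq_cutTerm {m : ℤ} (hm : 0 < m) {s j n : ℤ} (hj : j ∈ Finset.Ico s (s + 2 * m))
    (hn : n ≡ j [ZMOD 2 * m]) (τ z : ℂ) : RTerm j m τ z n = cutTerm m s τ z n := by
  obtain ⟨t, rfl⟩ := exists_eq_add_of_modEq hn
  rw [Finset.mem_Ico] at hj
  have hm' : (1 : ℝ) ≤ m := by exact_mod_cast hm
  have h : Real.sign (((j + 2 * m * t : ℤ) : ℝ) - 1 / 2 - j + 2 * m) = sgnGE s (j + 2 * m * t) := by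
    rcases le_or_gt 0 t with ht | ht
    · have ht' : (0 : ℝ) ≤ t := by exact_mod_cast ht
      rw [sgnGE, if_pos (by nlinarith), Real.sign_of_pos]
      push_cast
      nlinarith
    · have ht1 : t ≤ -1 := by omega
      have ht' : (t : ℝ) ≤ -1 := by exact_mod_cast ht1
      rw [sgnGE, if_neg (by nlinarith), Real.sign_of_neg]
      push_cast
      nlinarith
  rw [RTerm, cutTerm, h]

theorem tsum_modEq {m : ℤ} (hm : 0 < m) (s : ℤ) {f : ℤ → ℂ} (hf : Summable f) :
    ∑ j ∈ Finset.Ico s (s + 2 * m), ∑' n : {n : ℤ // n ≡ j [ZMOD 2 * m]}, f n = ∑' n, f n := by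
  have h : ∀ j, ∑' n : {n : ℤ // n ≡ j [ZMOD 2 * m]}, f n =
      ∑' n, Set.indicator {n : ℤ | n ≡ j [ZMOD 2 * m]} f n := fun j => tsum_subtype _ f
  simp only [h]
  rw [← Summable.tsum_finsetSum fun j _ => hf.indicator _]
  refine tsum_congr fun n => ?_
  simp only [Set.indicator_apply, Set.mem_ofPred_eq]
  rw [Finset.sum_eq_single_of_mem _ (representative_mem hm s n)]
  · rw [if_pos ((modEq_iff_eq_representative s n (representative_mem hm s n)).2 rfl)]
  · intro j hj hne
    rw [if_neg fun h => hne ((modEq_iff_eq_representative s n hj).1 h)]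

theorem summable_RTerm {m : ℤ} (hm : 0 < m) (j : ℤ) {τ : ℂ} (hτ : 0 < τ.im) (z : ℂ) :
    Summable fun n : {n : ℤ // n ≡ j [ZMOD 2 * m]} => RTerm j m τ z n :=
  ((summable_cutTerm hm j hτ z).subtype _).congr fun n =>
    (RTerm_eq_cutTerm hm (Finset.mem_Ico.2 ⟨le_rfl, by linarith⟩) n.2 τ z).symm

/-- Stated for a general `g` to serve both the theta series itself and the series of its norms. -/
theorem tsum_comp_thetaTerm {m : ℤ} (hm : 0 < m) {n j : ℤ} (h : n ≡ j [ZMOD 2 * m]) (τ z : ℂ)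
    {A : Type*} [AddCommMonoid A] [TopologicalSpace A] (g : ℂ → A) :
    ∑' a, g (thetaTerm n m τ z a) = ∑' a, g (thetaTerm j m τ z a) := by
  obtain ⟨t, rfl⟩ := exists_eq_add_of_modEq h
  simp only [thetaTerm_add_mul hm]
  exact (Equiv.addRight t).tsum_eq fun a => g (thetaTerm j m τ z a)

/-- The double series of the completion. -/
noncomputable def completionTerm (m s : ℤ) (τ z₁ z₂ : ℂ) (p : ℤ × ℤ) : ℂ :=
  cutTerm m s τ ((z₁ - z₂) / 2) p.1 * thetaTerm p.1 m τ (z₁ + z₂) p.2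

theorem summable_completionTerm {m : ℤ} (hm : 0 < m) (s : ℤ) {τ : ℂ} (hτ : 0 < τ.im)
    (z₁ z₂ : ℂ) : Summable (completionTerm m s τ z₁ z₂) := by
  refine Summable.of_norm ((summable_prod_of_nonneg fun _ => norm_nonneg _).2 ⟨fun n => ?_, ?_⟩)
  · simp only [completionTerm, norm_mul]
    exact (summable_thetaTerm hm n hτ _).norm.mul_left _
  · simp only [completionTerm, norm_mul, tsum_mul_left]
    have hθ : ∀ n : ℤ, 0 ≤ ∑' a, ‖thetaTerm n m τ (z₁ + z₂) a‖ :=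
      fun n => tsum_nonneg fun _ => norm_nonneg _
    -- The norm sums of the theta series depend only on n mod 2m, so the sum over the 2m
    -- representatives bounds them all.
    refine ((summable_cutTerm hm s hτ ((z₁ - z₂) / 2)).norm.mul_right
      (∑ j ∈ Finset.Ico s (s + 2 * m), ∑' a, ‖thetaTerm j m τ (z₁ + z₂) a‖)).of_nonneg_of_le
        (fun n => mul_nonneg (norm_nonneg _) (hθ n)) fun n => ?_
    refine mul_le_mul_of_nonneg_left ?_ (norm_nonneg _)
    rw [tsum_comp_thetaTerm hm ((modEq_iff_eq_representative s n
      (representative_mem hm s n)).2 rfl) τ (z₁ + z₂) fun x => ‖x‖]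
    exact Finset.single_le_sum (f := fun j => ∑' a, ‖thetaTerm j m τ (z₁ + z₂) a‖)
      (fun j _ => hθ j) (representative_mem hm s n)

theorem PhiAdd_eq_tsum {m : ℤ} (hm : 0 < m) (s : ℤ) {τ : ℂ} (hτ : 0 < τ.im) (z₁ z₂ : ℂ) :
    PhiAdd m s τ z₁ z₂ = ∑' n : ℤ, ∑' a : ℤ, completionTerm m s τ z₁ z₂ (n, a) := by
  rw [← tsum_modEq hm s (summable_completionTerm hm s hτ z₁ z₂).prod]
  refine Finset.sum_congr rfl fun j hj => ?_
  rw [R, ← tsum_mul_right]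
  refine tsum_congr fun n => ?_
  simp only [completionTerm]
  rw [tsum_mul_left, RTerm_eq_cutTerm hm hj n.2, Theta]
  exact congrArg _ (tsum_comp_thetaTerm hm n.2 τ _ id).symm

/-! ### Comparison of the rows -/

theorem latticeTerm_eq_gaussRow {m : ℤ} {τ : ℂ} (hτ : 0 < τ.im) (z₁ z₂ : ℂ) (a b : ℤ) :
    exp (-(2 * Real.pi * I * m * z₁ * (z₂.im / τ.im))) * latticeTerm m τ z₁ z₂ (a, b) =
      exp (2 * Real.pi * I * m * a * z₂) *
        (gaussRow (m / τ.im) (z₁ + a * τ) (m / τ.im * z₂.im) b / (z₁ + a * τ + b)) := by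
  have hτ' : (τ.im : ℂ) ≠ 0 := by exact_mod_cast hτ.ne'
  have hw : z₁ + (a * τ + b) = z₁ + a * τ + b := by ring
  have him : (((a * τ + b) * (starRingEnd ℂ) z₂).im : ℂ) =
      a * τ.im * z₂ - (a * τ + b) * z₂.im := by
    rw [mul_im]
    simp only [add_re, add_im, mul_re, mul_im, intCast_re, intCast_im, conj_re, conj_im]
    conv_rhs => rw [← re_add_im z₂, ← re_add_im τ]
    push_cast
    simp [-re_add_im]
    ring
  rw [latticeTerm, gaussRow, hw, ← mul_div_assoc (exp _), ← exp_add, ← mul_div_assoc (exp _), ← exp_add]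
  congr 2
  rw [ofReal_mul _ (((a * τ + b) * (starRingEnd ℂ) z₂).im), him]
  push_cast
  field_simp
  ring

theorem phiTerm_eq_row (m s : ℤ) (τ z₁ z₂ : ℂ) (a : ℤ) :
    phiTerm m s τ z₁ z₂ a = exp (2 * Real.pi * I * m * a * z₂) *
      (exp (2 * Real.pi * I * (s + m * a : ℤ) * (z₁ + a * τ)) /
        (1 - exp (2 * Real.pi * I * (z₁ + a * τ)))) := by
  rw [phiTerm, qPow, qPow, ← exp_add, ← exp_add, ← mul_div_assoc, ← exp_add]
  congr 2
  · push_cast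
    ring
  · congr 2
    ring

/-- The n²/(4m) from the theta exponent cancels the one in `R`. With k = n + ma, what remains is e(m
a z₂) e(k(z₁ + aτ)), and the cut s moves to s + ma. -/
theorem completionTerm_eq_errorTerm {m : ℤ} (hm : 0 < m) (s : ℤ) {τ : ℂ} (hτ : 0 < τ.im)
    (z₁ z₂ : ℂ) (n a : ℤ) :
    completionTerm m s τ z₁ z₂ (n, a) = exp (2 * Real.pi * I * m * a * z₂) *
      errorTerm (m / τ.im) (z₁ + a * τ) (s + m * a) (m / τ.im * z₂.im) (n + m * a) := by
  have hm' : (m : ℂ) ≠ 0 := by exact_mod_cast hm.ne'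
  have hs : sgnGE (s + m * a) (n + m * a) = sgnGE s n := by
    simp only [sgnGE, add_le_add_iff_right]
  have hψ : (((n + m * a : ℤ) : ℝ) + (m / τ.im * z₂.im - m / τ.im * (z₁ + a * τ).im)) *
      (√(m / τ.im))⁻¹ = psi m n τ ((z₁ - z₂) / 2) := by
    have h2 : ((z₁ - z₂) / 2).im = (z₁.im - z₂.im) / 2 := by
      rw [show (2 : ℂ) = ((2 : ℝ) : ℂ) by norm_num, div_ofReal_im, sub_im]
    rw [psi, ← Real.sqrt_inv, inv_div, h2]
    congr 1
    simp
    field_simp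
    ring
  rw [completionTerm, cutTerm, thetaTerm_eq_exp, errorTerm, hs, hψ, mul_assoc, ← exp_add,
    mul_left_comm (exp _), ← exp_add]
  congr 2
  push_cast
  field_simp
  ring

theorem row_eq {m : ℤ} (hm : 0 < m) (s : ℤ) {τ z₁ : ℂ} (h : InDomain τ z₁) (z₂ : ℂ) (a : ℤ) :
    -(2 * Real.pi * I)⁻¹ * ∑' b : ℤ,
        exp (-(2 * Real.pi * I * m * z₁ * (z₂.im / τ.im))) * latticeTerm m τ z₁ z₂ (a, b) =
      phiTerm m s τ z₁ z₂ a - 1 / 2 * ∑' n : ℤ, completionTerm m s τ z₁ z₂ (n, a) := by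
  have hc : (0 : ℝ) < m / τ.im := div_pos (by exact_mod_cast hm) h.1
  have hw : ∀ b : ℤ, z₁ + a * τ + b ≠ 0 := fun b => by
    rw [add_assoc]
    exact h.add_ne_zero a b
  have hI : 2 * Real.pi * I ≠ 0 := two_pi_I_ne_zero
  simp only [latticeTerm_eq_gaussRow h.1, completionTerm_eq_errorTerm hm s h.1]
  have he : ∑' n : ℤ, errorTerm (m / τ.im) (z₁ + a * τ) (s + m * a) (m / τ.im * z₂.im)
      (n + m * a) = ∑' n : ℤ, errorTerm (m / τ.im) (z₁ + a * τ) (s + m * a)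
        (m / τ.im * z₂.im) n := (Equiv.addRight (m * a)).tsum_eq _
  rw [tsum_mul_left, tsum_mul_left, he, phiTerm_eq_row]
  have hp := poleSum_eq hc hw (s + m * a) (m / τ.im * z₂.im)
  rw [poleSum] at hp
  rw [hp]
  field_simp

/-- By `row_eq`, each term is a lattice row plus half a completion row, and row sums of absolutely
convergent double series are summable. -/
theorem summable_phiTerm {m : ℤ} (hm : 0 < m) (s : ℤ) {τ z₁ : ℂ} (h : InDomain τ z₁) (z₂ : ℂ) :
    Summable (phiTerm m s τ z₁ z₂) := by
  have h1 := ((summable_latticeTerm hm h.1 z₁ z₂).mul_left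
    (exp (-(2 * Real.pi * I * m * z₁ * (z₂.im / τ.im))))).prod.mul_left (-(2 * Real.pi * I)⁻¹)
  have h2 := (summable_completionTerm hm s h.1 z₁ z₂).prod_symm.prod.mul_left (1 / 2)
  refine (h1.add h2).congr fun a => ?_
  rw [row_eq hm s h]
  exact sub_add_cancel _ _

theorem PhiTilde_eq_latticeSum {m : ℤ} (hm : 0 < m) (s : ℤ) {τ z₁ : ℂ} (h : InDomain τ z₁)
    (z₂ : ℂ) : PhiTilde m s τ z₁ z₂ = latticeSum m τ z₁ z₂ := by
  have h1 := (summable_latticeTerm hm h.1 z₁ z₂).mul_left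
    (exp (-(2 * Real.pi * I * m * z₁ * (z₂.im / τ.im))))
  have h2 := summable_completionTerm hm s h.1 z₁ z₂
  have h3 : Summable fun a : ℤ => ∑' n : ℤ, completionTerm m s τ z₁ z₂ (n, a) :=
    h2.prod_symm.prod
  have h4 : ∑' n : ℤ, ∑' a : ℤ, completionTerm m s τ z₁ z₂ (n, a) =
      ∑' a : ℤ, ∑' n : ℤ, completionTerm m s τ z₁ z₂ (n, a) :=
    (Summable.tsum_comm (f := fun n a => completionTerm m s τ z₁ z₂ (n, a)) h2).symm
  rw [latticeSum, ← tsum_mul_left, h1.tsum_prod, ← tsum_mul_left, PhiTilde, Phi,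
    PhiAdd_eq_tsum hm s h.1, h4, ← tsum_mul_left,
    ← (summable_phiTerm hm s h z₂).tsum_sub (h3.mul_left _)]
  exact tsum_congr fun a => (row_eq hm s h z₂ a).symm

/-! ### Transformations of the lattice sum -/

theorem div_im_eq (z w : ℂ) : (z / w).im = (z * (starRingEnd ℂ) w).im / normSq w := by
  rw [div_eq_mul_inv, inv_def, ← mul_assoc, im_mul_ofReal, div_eq_mul_inv]

theorem linear_ne_zero {τ : ℂ} (hτ : 0 < τ.im) {a b c d : ℤ} (hdet : a * d - b * c = 1) :
    (c : ℂ) * τ + d ≠ 0 := by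
  intro h
  have him : (c : ℝ) * τ.im = 0 := by simpa using congrArg im h
  have hc : c = 0 := by exact_mod_cast (mul_eq_zero.1 him).resolve_right hτ.ne'
  have hd : d = 0 := by
    rw [hc] at h
    exact_mod_cast (by simpa using h : (d : ℂ) = 0)
  rw [hc, hd] at hdet
  simp at hdet

theorem mobius_im {τ : ℂ} {a b c d : ℤ} (hdet : a * d - b * c = 1) :
    ((a * τ + b) / (c * τ + d)).im = τ.im / normSq (c * τ + d) := by
  have hdet' : (a : ℝ) * d - b * c = 1 := by exact_mod_cast hdet
  rw [div_im_eq]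
  congr 1
  rw [mul_im]
  simp only [add_re, add_im, mul_re, mul_im, intCast_re, intCast_im, conj_re, conj_im]
  linear_combination τ.im * hdet'

theorem InDomain.mobius {τ z₁ : ℂ} (h : InDomain τ z₁) {a b c d : ℤ}
    (hdet : a * d - b * c = 1) :
    InDomain ((a * τ + b) / (c * τ + d)) (z₁ / (c * τ + d)) := by
  have hj := linear_ne_zero h.1 hdet
  refine ⟨?_, fun p q hpq => h.2 (p * d + q * b) (p * c + q * a) ?_⟩
  · rw [mobius_im hdet]
    exact div_pos h.1 (normSq_pos.2 hj)
  · field_simp at hpq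
    rw [hpq]
    push_cast
    ring

theorem InDomain.add {τ z₁ : ℂ} (h : InDomain τ z₁) (a b : ℤ) :
    InDomain τ (z₁ + (a * τ + b)) := by
  refine ⟨h.1, fun p q hpq => h.2 (p - b) (q - a) ?_⟩
  push_cast
  linear_combination hpq

/-- The action of a matrix of determinant one on row vectors of integers. -/
def rowEquiv {a b c d : ℤ} (hdet : a * d - b * c = 1) : ℤ × ℤ ≃ ℤ × ℤ where
  toFun p := (p.1 * a + p.2 * c, p.1 * b + p.2 * d)
  invFun p := (p.1 * d - p.2 * c, p.2 * a - p.1 * b)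
  left_inv p := by
    ext <;> simp only
    · linear_combination p.1 * hdet
    · linear_combination p.2 * hdet
  right_inv p := by
    ext <;> simp only
    · linear_combination p.1 * hdet
    · linear_combination p.2 * hdet

/-- With j = cτ + d, the quantities |z₁ + λ|², Im(λ z̄₂) and Im τ all scale by |j|⁻², so the
exponent is invariant and only the denominator yields the factor j. -/
theorem latticeTerm_mobius (m : ℤ) {τ : ℂ} (hτ : 0 < τ.im) (z₁ z₂ : ℂ) {a b c d : ℤ}
    (hdet : a * d - b * c = 1) (p : ℤ × ℤ) :
    latticeTerm m ((a * τ + b) / (c * τ + d)) (z₁ / (c * τ + d)) (z₂ / (c * τ + d)) p =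
      (c * τ + d) * latticeTerm m τ z₁ z₂ (rowEquiv hdet p) := by
  have hj := linear_ne_zero hτ hdet
  have hn : normSq (c * τ + d) ≠ 0 := (normSq_pos.2 hj).ne'
  rw [latticeTerm, latticeTerm, mobius_im hdet]
  simp only [rowEquiv, Equiv.coe_fn_mk]
  set l : ℂ := ((p.1 * a + p.2 * c : ℤ) : ℂ) * τ + ((p.1 * b + p.2 * d : ℤ) : ℂ) with hl
  have h1 : p.1 * ((a * τ + b) / (c * τ + d)) + p.2 = l / (c * τ + d) := by
    rw [eq_div_iff hj, add_mul, ← mul_div_assoc, div_mul_cancel₀ _ hj, hl]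
    push_cast
    ring
  have h2 : (l / (c * τ + d) * (starRingEnd ℂ) (z₂ / (c * τ + d))).im =
      (l * (starRingEnd ℂ) z₂).im / normSq (c * τ + d) := by
    rw [map_div₀, div_mul_div_comm, mul_conj, div_ofReal_im]
  rw [h1, h2, ← add_div, normSq_div, div_div_eq_mul_div, mul_comm (_ + _) (exp _ / _),
    div_mul_eq_mul_div]
  all_goals field_simp

theorem latticeSum_mobius (m : ℤ) {τ : ℂ} (hτ : 0 < τ.im) (z₁ z₂ : ℂ) {a b c d : ℤ}
    (hdet : a * d - b * c = 1) :
    latticeSum m ((a * τ + b) / (c * τ + d)) (z₁ / (c * τ + d)) (z₂ / (c * τ + d)) =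
      (c * τ + d) * exp (2 * Real.pi * I * m * c * z₁ * z₂ / (c * τ + d)) *
        latticeSum m τ z₁ z₂ := by
  have hj := linear_ne_zero hτ hdet
  have hn : normSq (c * τ + d) ≠ 0 := (normSq_pos.2 hj).ne'
  have hτ' : (τ.im : ℂ) ≠ 0 := by exact_mod_cast hτ.ne'
  -- The non-holomorphic ratio changes by a term linear in z₂; multiplied by z₁/(cτ + d), that term
  -- produces the index m factor.
  have h1 : (((z₂ / (c * τ + d)).im / (τ.im / normSq (c * τ + d)) : ℝ) : ℂ) =
      (z₂.im * (c * τ + d) - z₂ * (c * τ.im)) / τ.im := by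
    have h2 : (((z₂ * (starRingEnd ℂ) (c * τ + d)).im : ℝ) : ℂ) =
        z₂.im * (c * τ + d) - z₂ * (c * τ.im) := by
      rw [mul_im]
      simp only [add_re, add_im, mul_re, mul_im, intCast_re, intCast_im, conj_re, conj_im]
      conv_rhs => rw [← re_add_im z₂, ← re_add_im τ]
      push_cast
      simp [-re_add_im]
      ring
    rw [← h2, div_im_eq, ← ofReal_div]
    congr 1
    field_simp
  have h3 : exp (-(2 * Real.pi * I * m * (z₁ / (c * τ + d)) *
      (((z₂ / (c * τ + d)).im / (τ.im / normSq (c * τ + d)) : ℝ) : ℂ))) =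
      exp (2 * Real.pi * I * m * c * z₁ * z₂ / (c * τ + d)) *
        exp (-(2 * Real.pi * I * m * z₁ * (z₂.im / τ.im))) := by
    rw [h1, ← exp_add]
    congr 1
    field_simp
    ring
  rw [latticeSum, latticeSum, tsum_congr (latticeTerm_mobius m hτ z₁ z₂ hdet), tsum_mul_left,
    (rowEquiv hdet).tsum_eq (latticeTerm m τ z₁ z₂), mobius_im hdet, ← ofReal_div, h3]
  ring

theorem latticeSum_add_left (m : ℤ) {τ : ℂ} (hτ : 0 < τ.im) (z₁ z₂ : ℂ) (a b : ℤ) :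
    latticeSum m τ (z₁ + (a * τ + b)) z₂ =
      exp (-(2 * Real.pi * I * m * a * z₂)) * latticeSum m τ z₁ z₂ := by
  have hτ' : (τ.im : ℂ) ≠ 0 := by exact_mod_cast hτ.ne'
  have hterm : ∀ p : ℤ × ℤ, latticeTerm m τ (z₁ + (a * τ + b)) z₂ p =
      exp (-(2 * Real.pi * I * (m / τ.im * ((a * τ + b) * (starRingEnd ℂ) z₂).im : ℝ))) *
        latticeTerm m τ z₁ z₂ (p + (a, b)) := by
    intro p
    rw [latticeTerm, latticeTerm, ← mul_div_assoc (exp _), ← exp_add]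
    have h1 : z₁ + (a * τ + b) + (p.1 * τ + p.2) =
        z₁ + (((p + (a, b)).1 : ℤ) * τ + ((p + (a, b)).2 : ℤ)) := by
      simp only [Prod.fst_add, Prod.snd_add]
      push_cast
      ring
    have h2 : ((((p + (a, b)).1 : ℤ) * τ + ((p + (a, b)).2 : ℤ)) * (starRingEnd ℂ) z₂).im =
        ((p.1 * τ + p.2) * (starRingEnd ℂ) z₂).im + ((a * τ + b) * (starRingEnd ℂ) z₂).im := by
      rw [← add_im]
      simp only [Prod.fst_add, Prod.snd_add]
      push_cast
      ring_nf
    rw [h1, h2]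
    congr 2
    push_cast
    ring
  have him : (((a * τ + b) * (starRingEnd ℂ) z₂).im : ℂ) =
      a * τ.im * z₂ - (a * τ + b) * z₂.im := by
    rw [mul_im]
    simp only [add_re, add_im, mul_re, mul_im, intCast_re, intCast_im, conj_re, conj_im]
    conv_rhs => rw [← re_add_im z₂, ← re_add_im τ]
    push_cast
    simp [-re_add_im]
    ring
  have h3 : exp (-(2 * Real.pi * I * m * (z₁ + (a * τ + b)) * (z₂.im / τ.im))) *
      exp (-(2 * Real.pi * I * (m / τ.im * ((a * τ + b) * (starRingEnd ℂ) z₂).im : ℝ))) =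
      exp (-(2 * Real.pi * I * m * a * z₂)) *
        exp (-(2 * Real.pi * I * m * z₁ * (z₂.im / τ.im))) := by
    rw [← exp_add, ← exp_add, ofReal_mul, him]
    congr 1
    push_cast
    field_simp
    ring
  have hsum : ∑' p : ℤ × ℤ, latticeTerm m τ z₁ z₂ (p + (a, b)) =
      ∑' p : ℤ × ℤ, latticeTerm m τ z₁ z₂ p :=
    (Equiv.addRight ((a, b) : ℤ × ℤ)).tsum_eq (latticeTerm m τ z₁ z₂)
  rw [latticeSum, latticeSum, tsum_congr hterm, tsum_mul_left, hsum, ← mul_assoc (exp _) (exp _),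
    h3]
  ring

theorem latticeSum_add_right (m : ℤ) {τ : ℂ} (hτ : 0 < τ.im) (z₁ z₂ : ℂ) (a b : ℤ) :
    latticeSum m τ z₁ (z₂ + (a * τ + b)) =
      exp (-(2 * Real.pi * I * m * a * z₁)) * latticeSum m τ z₁ z₂ := by
  have hτ' : (τ.im : ℂ) ≠ 0 := by exact_mod_cast hτ.ne'
  have hterm : ∀ p : ℤ × ℤ,
      latticeTerm m τ z₁ (z₂ + (a * τ + b)) p = latticeTerm m τ z₁ z₂ p := by
    intro p
    -- For lattice points λ and μ, Im(λ μ̄) is an integer multiple of Im τ, so the phase changes by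
    -- an integer.
    have h : m / τ.im * ((p.1 * τ + p.2) * (starRingEnd ℂ) (z₂ + (a * τ + b))).im =
        m / τ.im * ((p.1 * τ + p.2) * (starRingEnd ℂ) z₂).im +
          ((m * (p.1 * b - p.2 * a) : ℤ) : ℝ) := by
      have : ((p.1 * τ + p.2) * (starRingEnd ℂ) (a * τ + b)).im =
          τ.im * (p.1 * b - p.2 * a) := by
        rw [mul_im]
        simp only [add_re, add_im, mul_re, mul_im, intCast_re, intCast_im, conj_re, conj_im]
        ring
      rw [map_add, mul_add, add_im, this]
      push_cast
      field_simp [hτ.ne']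
    rw [latticeTerm, latticeTerm, h]
    congr 1
    refine exp_eq_exp_iff_exists_int.2 ⟨m * (p.1 * b - p.2 * a), ?_⟩
    push_cast
    ring
  rw [latticeSum, latticeSum, tsum_congr hterm]
  have h3 : exp (-(2 * Real.pi * I * m * z₁ * ((z₂ + (a * τ + b)).im / τ.im))) =
      exp (-(2 * Real.pi * I * m * a * z₁)) *
        exp (-(2 * Real.pi * I * m * z₁ * (z₂.im / τ.im))) := by
    rw [← exp_add]
    congr 1
    simp
    field_simp
    ring
  rw [h3]
  ring

/-! ### Transformations of the modified mock theta function -/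

theorem PhiTilde_mobius {m : ℤ} (hm : 0 < m) (s s₁ : ℤ) {τ z₁ : ℂ} (h : InDomain τ z₁) (z₂ : ℂ)
    {a b c d : ℤ} (hdet : a * d - b * c = 1) :
    PhiTilde m s ((a * τ + b) / (c * τ + d)) (z₁ / (c * τ + d)) (z₂ / (c * τ + d)) =
      (c * τ + d) * exp (2 * Real.pi * I * m * c * z₁ * z₂ / (c * τ + d)) *
        PhiTilde m s₁ τ z₁ z₂ := by
  rw [PhiTilde_eq_latticeSum hm s (h.mobius hdet), PhiTilde_eq_latticeSum hm s₁ h,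
    latticeSum_mobius m h.1 z₁ z₂ hdet]

theorem slash_PhiTilde {m : ℤ} (hm : 0 < m) (s : ℤ) (g : Matrix.SpecialLinearGroup (Fin 2) ℤ)
    {τ z₁ : ℂ} (h : InDomain τ z₁) (z₂ : ℂ) :
    slash m g (PhiTilde m s) τ z₁ z₂ = PhiTilde m s τ z₁ z₂ := by
  have hdet : g 0 0 * g 1 1 - g 0 1 * g 1 0 = 1 := by
    rw [← Matrix.det_fin_two]
    exact g.det_coe
  have hj := linear_ne_zero h.1 hdet
  rw [slash, PhiTilde_mobius hm s s h z₂ hdet, neg_div, exp_neg]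
  have he := exp_ne_zero (2 * Real.pi * I * m * g 1 0 * z₁ * z₂ / (g 1 0 * τ + g 1 1))
  generalize exp (2 * Real.pi * I * m * g 1 0 * z₁ * z₂ / (g 1 0 * τ + g 1 1)) = e at he ⊢
  field_simp

theorem PhiTilde_add_lattice {m : ℤ} (hm : 0 < m) (s : ℤ) {τ z₁ : ℂ} (h : InDomain τ z₁) (z₂ : ℂ)
    (a b c d : ℤ) :
    PhiTilde m s τ (z₁ + (a * τ + c)) (z₂ + (b * τ + d)) =
      exp (-(2 * Real.pi * I * m * (b * z₁ + a * z₂))) * qPow τ (-(m * a * b)) *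
        PhiTilde m s τ z₁ z₂ := by
  rw [PhiTilde_eq_latticeSum hm s (h.add a c), PhiTilde_eq_latticeSum hm s h,
    latticeSum_add_left m h.1, latticeSum_add_right m h.1, ← mul_assoc, qPow, ← exp_add,
    ← exp_add]
  congr 1
  -- The z₁ shift is applied at z₂ + bτ + d: bτ gives q^(-mab), while d contributes only e(-mad) =
  -- 1.
  refine exp_eq_exp_iff_exists_int.2 ⟨-(m * a * d), ?_⟩
  push_cast
  ring

end MockTheta

theorem theorem1p1 (m : ℤ) (hm : 0 < m) :
    -- all the series involved converge absolutely
    ((∀ (s : ℤ) (τ z₁ z₂ : ℂ), MockTheta.InDomain τ z₁ →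
        Summable (MockTheta.phiTerm m s τ z₁ z₂)) ∧
      (∀ (j : ℤ) (τ z : ℂ), 0 < τ.im → Summable (MockTheta.thetaTerm j m τ z)) ∧
      (∀ (j : ℤ) (τ z : ℂ), 0 < τ.im →
        Summable fun n : {n : ℤ // n ≡ j [ZMOD 2 * m]} => MockTheta.RTerm j m τ z n)) ∧
    -- modular transformations
    (∀ (s s₁ : ℤ) (τ z₁ z₂ : ℂ), MockTheta.InDomain τ z₁ →
      MockTheta.PhiTilde m s (-1 / τ) (z₁ / τ) (z₂ / τ) =
        τ * Complex.exp (2 * Real.pi * Complex.I * m / τ * z₁ * z₂) *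
          MockTheta.PhiTilde m s₁ τ z₁ z₂) ∧
    (∀ (s : ℤ) (τ z₁ z₂ : ℂ), MockTheta.InDomain τ z₁ →
      MockTheta.PhiTilde m s (τ + 1) z₁ z₂ = MockTheta.PhiTilde m s τ z₁ z₂) ∧
    -- elliptic transformations
    (∀ (s a b : ℤ) (τ z₁ z₂ : ℂ), MockTheta.InDomain τ z₁ →
      MockTheta.PhiTilde m s τ (z₁ + a * τ) (z₂ + b * τ) =
        Complex.exp (-(2 * Real.pi * Complex.I * m * (b * z₁ + a * z₂))) *
          MockTheta.qPow τ (-(m * a * b)) * MockTheta.PhiTilde m s τ z₁ z₂) ∧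
    (∀ (s a b : ℤ) (τ z₁ z₂ : ℂ), MockTheta.InDomain τ z₁ →
      MockTheta.PhiTilde m s τ (z₁ + a) (z₂ + b) = MockTheta.PhiTilde m s τ z₁ z₂) ∧
    -- independence of `s` and invariance under `SL₂(ℤ)`
    (∀ (s s₁ : ℤ) (τ z₁ z₂ : ℂ), MockTheta.InDomain τ z₁ →
      MockTheta.PhiTilde m s τ z₁ z₂ = MockTheta.PhiTilde m s₁ τ z₁ z₂) ∧
    (∀ (s : ℤ) (g : Matrix.SpecialLinearGroup (Fin 2) ℤ) (τ z₁ z₂ : ℂ),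
      MockTheta.InDomain τ z₁ →
      MockTheta.slash m g (MockTheta.PhiTilde m s) τ z₁ z₂ =
        MockTheta.PhiTilde m s τ z₁ z₂) := by
  refine ⟨⟨fun s τ z₁ z₂ h => MockTheta.summable_phiTerm hm s h z₂,
    fun j τ z h => MockTheta.summable_thetaTerm hm j h z,
    fun j τ z h => MockTheta.summable_RTerm hm j h z⟩, ?_, ?_, ?_, ?_, ?_, ?_⟩
  · intro s s₁ τ z₁ z₂ h
    have := MockTheta.PhiTilde_mobius hm s s₁ h z₂ (a := 0) (b := -1) (c := 1) (d := 0) (by norm_num)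
    simp only [Int.cast_zero, Int.cast_one, Int.cast_neg, zero_mul, zero_add, one_mul, add_zero,
      mul_one] at this
    rw [this]
    congr 3
    ring
  · intro s τ z₁ z₂ h
    have := MockTheta.PhiTilde_mobius hm s s h z₂ (a := 1) (b := 1) (c := 0) (d := 1) (by norm_num)
    simpa using this
  · intro s a b τ z₁ z₂ h
    have := MockTheta.PhiTilde_add_lattice hm s h z₂ a b 0 0
    simpa only [Int.cast_zero, add_zero] using this
  · intro s a b τ z₁ z₂ h
    have := MockTheta.PhiTilde_add_lattice hm s h z₂ 0 0 a b
    simpa [MockTheta.qPow] using this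
  · intro s s₁ τ z₁ z₂ h
    rw [MockTheta.PhiTilde_eq_latticeSum hm s h, MockTheta.PhiTilde_eq_latticeSum hm s₁ h]
  · intro s g τ z₁ z₂ h
    exact MockTheta.slash_PhiTilde hm s g h z₂
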